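/- Let $M^n$, $n\ge 3$, be a closed (compact, without boundary), simply-connected smooth manifold with a smooth action of the circle $S^1$ that is fixed point homogeneous, i.e. $\operatorname{Fix}(M;S^1)\neq\emptyset$ and $\dim(M/S^1)=\dim \operatorname{Fix}(M;S^1)+1$. Let $F^{n-2}$ be a connected component of $\operatorname{Fix}(M;S^1)$ of codimension two. Let $N^{n-2}\subset M$ be an $S^1$-invariant smooth submanifold of codimension two that contains all singularities of the action outside of $F$, that is, every point of $M\setminus F$ whose orbit is not principal (an orbit is principal if its isotropy group is the smallest possible one). Suppose that $M$ decomposes as the union $$M=D(F)\cup_E D(N)$$ of the (smoothly embedded, closed) normal $2$-disk bundles $D(F)$ of $F$ and $D(N)$ of $N$, glued along their common boundary $E=\partial D(F)=\partial D(N)=D(F)\cap D(N)$. Then $\pi_1(F)$ and $\pi_1(N)$ are cyclic groups (finite or infinite, possibly trivial; for every choice of base point). -/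

import Mathlib

open scoped Manifold ContDiff Bundle

section Actions

variable (G M : Type*) [Group G] [TopologicalSpace M] [MulAction G M]

/-- A `G`-action is fixed point homogeneous if its fixed-point cohomogeneity
`dim (M / G) - dim (M ^ G) - 1` is zero, the fixed point set being nonempty.
(The dimension of an empty space is `⊥` and `⊥ + 1 = ⊥`, so the equation
`dim (M / G) = dim (M ^ G) + 1` forces `M ^ G` to be nonempty as soon as `M` is.) -/
def IsFixedPointHomogeneous : Prop :=
  smallInductiveDimension (MulAction.orbitRel.Quotient G M) =
    smallInductiveDimension (MulAction.fixedPoints G M) + 1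

variable {M} in
/-- The orbit of `x` is principal: its isotropy group is the smallest one, up to conjugation. -/
def HasPrincipalOrbit (x : M) : Prop :=
  ∀ y : M, ∃ g : G, MulAction.stabilizer G x ≤ MulAction.stabilizer G (g • y)

end Actions

section DiskBundles

/-- The standard fibre of a plane bundle. -/
abbrev Plane : Type := EuclideanSpace ℝ (Fin 2)

/-- The closed unit disk bundle of a plane bundle with a fibre metric. -/
def closedDiskBundle {B : Type*} (V : B → Type*) [∀ x, NormedAddCommGroup (V x)] :
    Set (Bundle.TotalSpace Plane V) :=
  {v | ‖v.2‖ ≤ 1}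

/-- The unit circle bundle of a plane bundle with a fibre metric. -/
def unitCircleBundle {B : Type*} (V : B → Type*) [∀ x, NormedAddCommGroup (V x)] :
    Set (Bundle.TotalSpace Plane V) :=
  {v | ‖v.2‖ = 1}

/-- `φ` exhibits the closed unit disk bundle `D` of the plane bundle `V → B` as a closed tubular
neighbourhood of the submanifold `ι : B → M` of codimension two: `φ` restricts to a smooth
embedding of the manifold with boundary `D` onto a closed codimension zero piece of `M`, and it is
`ι` on the zero section (so that `V` is isomorphic to the normal bundle of `B` in `M`).
Smoothness on `D` is expressed, as usual, by means of an extension to a neighbourhood of `D` in the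
total space; the values of `φ` away from such a neighbourhood are irrelevant. -/
structure IsTubularDiskBundle {n b : ℕ} {M B : Type*}
    [TopologicalSpace M] [ChartedSpace (EuclideanSpace ℝ (Fin n)) M]
    [TopologicalSpace B] [ChartedSpace (EuclideanSpace ℝ (Fin b)) B]
    (ι : B → M) (V : B → Type*) [TopologicalSpace (Bundle.TotalSpace Plane V)]
    [∀ x, NormedAddCommGroup (V x)] [∀ x, InnerProductSpace ℝ (V x)]
    [FiberBundle Plane V] [VectorBundle ℝ Plane V]
    (φ : Bundle.TotalSpace Plane V → M) : Prop where
  zeroSection : ∀ x : B, φ ⟨x, 0⟩ = ι x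
  isLocalDiffeomorphOn :
    IsLocalDiffeomorphOn ((𝓡 b).prod 𝓘(ℝ, Plane)) (𝓡 n) ∞ φ (closedDiskBundle V)
  isClosedEmbedding : Topology.IsClosedEmbedding ((closedDiskBundle V).domRestrict φ)

/-- `M = D(F) ∪_E D(N)`: the (embedded) closed disk bundles of `V → F` and `W → N` cover `M` and
meet exactly in `E`, which is the boundary circle bundle of each of them. -/
structure IsDiskBundleDecomposition {M F N : Type*}
    {V : F → Type*} [∀ x, NormedAddCommGroup (V x)]
    {W : N → Type*} [∀ x, NormedAddCommGroup (W x)]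
    (φ : Bundle.TotalSpace Plane V → M) (ψ : Bundle.TotalSpace Plane W → M) : Prop where
  cover : φ '' closedDiskBundle V ∪ ψ '' closedDiskBundle W = Set.univ
  inter_eq_left : φ '' closedDiskBundle V ∩ ψ '' closedDiskBundle W = φ '' unitCircleBundle V
  inter_eq_right : φ '' closedDiskBundle V ∩ ψ '' closedDiskBundle W = ψ '' unitCircleBundle W

end DiskBundles

/-!
The cyclicity comes from the topology of the decomposition of the simply connected space `M` into
two disk bundles. Their common boundary `E` is the total space of circle bundles `p : E → F` and
`q : E → N`. By van Kampen, `π₁(M) = 1` is the quotient of `π₁(E)` by the product of the kernels of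
`p_*` and `q_*`, which are the images of the fundamental groups of the fibres; hence `π₁(F)`, the
quotient of `π₁(E)` by the first kernel, is the image of the second one, which is cyclic. The same
holds with `F` and `N` exchanged.

In place of groups and base points, the formal argument uses cocycles on paths (`PathCocycle`), that
is functors from the fundamental groupoid to a group `Q`. Two facts carry the proof.

* `PathCocycle.eq_one_of_homotopic_refl`, the part of the van Kampen theorem that is needed:
  cocycles on the members of an open cover that agree on overlaps are trivial on null-homotopic
  loops.
* `PathCocycle.mem_fibreSubgroup_of_union`: let `C` be the subgroup of `π₁(F)` given by the loops in
  one fibre of `q`. It is normal, because loops of `F` lift to `E` and conjugation by paths of `E`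
  preserves fibre loops. The cocycle of `E` with values in `π₁(F) / C` is trivial on the loops in
  the fibres of `q`, so up to a coboundary it descends to `N` over trivializing sets. This yields
  compatible cocycles on an open cover of `M`. As `M` is simply connected, every loop of `F` is trivial in `π₁(F) / C`.

The geometric part (`IsDiskBundleDecomposition.isCyclic_fundamentalGroup_left`) provides the circle
bundles `p` and `q`, and the retraction of `M \ N` to `F` that follows the radii of the disk
bundles. Path connectedness of `N`, needed for the exchange of `F` and `N`, follows from that of
`E`.
-/

/-! ### Paths and open covers -/

section Paths

open unitInterval Set

/-- A path in `X` that stays in `O`, as a path in the subspace `O`. -/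
def Path.restrictCodomain {X : Type*} [TopologicalSpace X] {x y : X} (γ : Path x y) {O : Set X}
    (h : ∀ t, γ t ∈ O) :
    Path (⟨x, γ.source ▸ h 0⟩ : O) ⟨y, γ.target ▸ h 1⟩ where
  toFun t := ⟨γ t, h t⟩
  continuous_toFun := by fun_prop
  source' := by simp
  target' := by simp

/-- To prove a property of all paths, it is enough to prove it for the paths inside the members of
an open cover, if the property is invariant under homotopy and stable under concatenation. -/
theorem Path.induction_of_openCover {X ι : Type*} [TopologicalSpace X] {O : ι → Set X}
    (hO : ∀ i, IsOpen (O i)) (hcov : ∀ x, ∃ i, x ∈ O i)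
    {P : ∀ {x y : X}, Path x y → Prop}
    (homotopic : ∀ {x y : X} {γ δ : Path x y}, γ.Homotopic δ → P γ → P δ)
    (trans : ∀ {x y z : X} (γ : Path x y) (δ : Path y z), P γ → P δ → P (γ.trans δ))
    (local_ : ∀ (i : ι) {x y : X} (γ : Path x y), (∀ t, γ t ∈ O i) → P γ)
    {x y : X} (γ : Path x y) : P γ := by
  obtain ⟨t, ht0, htmono, ⟨n, hn⟩, hsub⟩ :=
    exists_monotone_Icc_subset_open_cover_unitInterval (c := fun i ↦ γ ⁻¹' (O i))
      (fun i ↦ (hO i).preimage γ.continuous)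
      (fun s _ ↦ by obtain ⟨i, hi⟩ := hcov (γ s); exact mem_iUnion.2 ⟨i, hi⟩)
  have piece (k : ℕ) : P (γ.subpath (t k) (t (k + 1))) := by
    obtain ⟨i, hi⟩ := hsub k
    refine local_ i _ fun s ↦ ?_
    have : γ.subpath (t k) (t (k + 1)) s ∈ γ '' Icc (t k) (t (k + 1)) := by
      rw [← Path.range_subpath_of_le _ _ _ (htmono k.le_succ)]
      exact mem_range_self s
    obtain ⟨u, hu, hu'⟩ := this
    rw [← hu']
    exact hi hu
  have initial (k : ℕ) : P (γ.subpath (t 0) (t (k + 1))) := by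
    induction k with
    | zero => exact piece 0
    | succ k ih =>
      exact homotopic ⟨Path.Homotopy.subpathTransSubpath γ _ _ _⟩ (trans _ _ ih (piece _))
  have key := initial n
  have aux : ∀ {a b : I} (ha : a = 0) (hb : b = 1), P (γ.subpath a b) → P γ := by
    rintro _ _ rfl rfl h
    rw [Path.subpath_zero_one] at h
    have cast_aux : ∀ {x' y' : X} (hx : x' = x) (hy : y' = y), P (γ.cast hx hy) → P γ := by
      rintro _ _ rfl rfl h
      exact h
    exact cast_aux _ _ h
  exact aux ht0 (hn _ n.le_succ) key

end Paths

/-! ### Cocycles on paths -/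

/-- A `Q`-valued cocycle on the paths of `X`: a functor from the fundamental groupoid of `X` to the
group `Q`, described as a multiplicative and homotopy invariant function on paths. -/
structure PathCocycle (X : Type*) [TopologicalSpace X] (Q : Type*) [Group Q] where
  /-- the value on a path -/
  toFun : ∀ {x y : X}, Path x y → Q
  map_trans' : ∀ {x y z : X} (γ : Path x y) (δ : Path y z),
    toFun (γ.trans δ) = toFun γ * toFun δ
  map_homotopic' : ∀ {x y : X} {γ δ : Path x y}, γ.Homotopic δ → toFun γ = toFun δ

namespace PathCocycle

open unitInterval Set

variable {X Y Q : Type*} [TopologicalSpace X] [TopologicalSpace Y] [Group Q]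

instance : CoeFun (PathCocycle X Q) (fun _ ↦ ∀ {x y : X}, Path x y → Q) := ⟨fun f ↦ f.toFun⟩

variable (f : PathCocycle X Q)

theorem map_trans {x y z : X} (γ : Path x y) (δ : Path y z) : f (γ.trans δ) = f γ * f δ :=
  f.map_trans' γ δ

theorem map_homotopic {x y : X} {γ δ : Path x y} (h : γ.Homotopic δ) : f γ = f δ :=
  f.map_homotopic' h

@[simp]
theorem map_refl (x : X) : f (Path.refl x) = 1 := by
  have h := f.map_trans (Path.refl x) (Path.refl x)
  rw [Path.refl_trans_refl] at h
  simpa using h.symm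

@[simp]
theorem map_symm {x y : X} (γ : Path x y) : f γ.symm = (f γ)⁻¹ := by
  rw [eq_inv_iff_mul_eq_one, ← map_trans, ← f.map_homotopic ⟨Path.Homotopy.reflSymmTrans γ⟩,
    map_refl]

@[simp]
theorem map_cast {x y x' y' : X} (γ : Path x y) (hx : x' = x) (hy : y' = y) :
    f (γ.cast hx hy) = f γ := by
  subst hx hy; rfl

theorem congr {x y x' y' : X} {γ : Path x y} {γ' : Path x' y'} (h : ∀ t, γ t = γ' t) :
    f γ = f γ' := by
  have hx : x = x' := by simpa using h 0
  have hy : y = y' := by simpa using h 1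
  subst hx hy
  rw [show γ = γ' from Path.ext (funext h)]

/-- The pullback of a cocycle under a continuous map. -/
def comap (f : PathCocycle Y Q) (g : C(X, Y)) : PathCocycle X Q where
  toFun γ := f (γ.map g.continuous)
  map_trans' γ δ := by rw [Path.map_trans, f.map_trans]
  map_homotopic' h := f.map_homotopic (h.map g)

@[simp]
theorem comap_apply (f : PathCocycle Y Q) (g : C(X, Y)) {x y : X} (γ : Path x y) :
    f.comap g γ = f (γ.map g.continuous) := rfl

/-- The cocycle cohomologous to `f` by means of an arbitrary (not necessarily continuous)
function `c`. -/
def twist (f : PathCocycle X Q) (c : X → Q) : PathCocycle X Q where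
  toFun {x y} γ := c x * f γ * (c y)⁻¹
  map_trans' γ δ := by rw [f.map_trans]; group
  map_homotopic' h := by rw [f.map_homotopic h]

@[simp]
theorem twist_apply (c : X → Q) {x y : X} (γ : Path x y) :
    f.twist c γ = c x * f γ * (c y)⁻¹ := rfl

/-- A cocycle takes the same value along the two ways around a square. -/
theorem map_square (K : C(I × I, X)) {x₀₀ x₀₁ x₁₀ x₁₁ : X} {b : Path x₀₀ x₀₁} {t : Path x₁₀ x₁₁}
    {l : Path x₀₀ x₁₀} {r : Path x₀₁ x₁₁} (hb : ∀ s, b s = K (0, s)) (ht : ∀ s, t s = K (1, s))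
    (hl : ∀ s, l s = K (s, 0)) (hr : ∀ s, r s = K (s, 1)) :
    f b * f r = f l * f t := by
  let j : Path (0 : I) 1 := ⟨⟨id, continuous_id⟩, rfl, rfl⟩
  have hbot : f b = f.comap K ((Path.refl 0).prod j) := f.congr hb
  have htop : f t = f.comap K ((Path.refl 1).prod j) := f.congr ht
  have hleft : f l = f.comap K (j.prod (Path.refl 0)) := f.congr hl
  have hright : f r = f.comap K (j.prod (Path.refl 1)) := f.congr hr
  rw [hbot, htop, hleft, hright, ← map_trans, ← map_trans]
  have : ContractibleSpace I := (convex_Icc (0 : ℝ) 1).contractibleSpace ⟨0, by simp⟩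
  exact map_homotopic _ (SimplyConnectedSpace.paths_homotopic _ _)

section Glue

variable {ι : Type*} {O : ι → Set X} (g : ∀ i, PathCocycle (O i) Q)

open Classical in
/-- The common value, on a path that lies in a member of a cover, of cocycles on the members that
agree on the overlaps; `1` on the other paths. -/
noncomputable def localValue {x y : X} (γ : Path x y) : Q :=
  if h : ∃ i, ∀ t, γ t ∈ O i then g h.choose (γ.restrictCodomain h.choose_spec) else 1

variable {g} (hcompat : ∀ (i j : ι) {x y : X} (γ : Path x y) (hi : ∀ t, γ t ∈ O i)
  (hj : ∀ t, γ t ∈ O j), g i (γ.restrictCodomain hi) = g j (γ.restrictCodomain hj))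
include hcompat

theorem localValue_eq {x y : X} (γ : Path x y) {i : ι} (hi : ∀ t, γ t ∈ O i) :
    localValue g γ = g i (γ.restrictCodomain hi) := by
  have h : ∃ i, ∀ t, γ t ∈ O i := ⟨i, hi⟩
  rw [localValue, dif_pos h]
  exact hcompat _ _ _ _ _

/-- The uniqueness part of the Seifert-van Kampen theorem, for an arbitrary open cover: if cocycles
on the members of the cover agree on the overlaps, then each of them is trivial on the loops that
are null-homotopic in the whole space.

The null-homotopy is subdivided into small squares. The products of the values along two consecutive
rows of the subdivision agree; the first is the value of the loop, the last is `1`. -/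
theorem eq_one_of_homotopic_refl (hO : ∀ i, IsOpen (O i)) (hcov : ∀ x, ∃ i, x ∈ O i)
    {i : ι} {x : X} {γ : Path x x} (hγ : ∀ t, γ t ∈ O i) (hnull : γ.Homotopic (Path.refl x)) :
    g i (γ.restrictCodomain hγ) = 1 := by
  obtain ⟨H⟩ := hnull
  obtain ⟨t, ht0, htmono, ⟨n, hn⟩, hsub⟩ :=
    exists_monotone_Icc_subset_open_cover_unitInterval_prod_self (c := fun i ↦ H ⁻¹' (O i))
      (fun i ↦ (hO i).preimage H.continuous)
      (fun s _ ↦ by obtain ⟨i, hi⟩ := hcov (H s); exact mem_iUnion.2 ⟨i, hi⟩)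
  have htn : t n = 1 := hn n le_rfl
  let column (s : I) : Path (γ s) (x) :=
    ⟨⟨fun a ↦ H (a, s), by fun_prop⟩, by simp, by simp⟩
  -- `h k m` and `v k m` are the values on the horizontal and the vertical edge of the subdivision
  -- that start at the vertex `(t k, t m)`.
  let h (k m : ℕ) : Q := localValue g ((H.eval (t k)).subpath (t m) (t (m + 1)))
  let v (k m : ℕ) : Q := localValue g ((column (t m)).subpath (t k) (t (k + 1)))
  have subpath_apply {y z : X} (δ : Path y z) (a b s : I) :
      δ.subpath a b s = δ (Icc.convexComb a b s) := rfl
  have eval_apply (a s : I) : H.eval a s = H (a, s) := rfl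
  have column_apply (a s : I) : column s a = H (a, s) := rfl
  have value_refl (y : X) : localValue g (Path.refl y) = 1 := by
    obtain ⟨i, hi⟩ := hcov y
    rw [localValue_eq hcompat (Path.refl y) (i := i) (fun _ ↦ hi)]
    exact (g i).map_refl _
  have value_const {y z : X} (δ : Path y z) (w : X) (hδ : ∀ s, δ s = w) : localValue g δ = 1 := by
    obtain rfl : y = w := by rw [← hδ 0, δ.source]
    obtain rfl : z = y := by rw [← hδ 1, δ.target]
    rw [show δ = Path.refl _ from Path.ext (funext hδ), value_refl]
  have square (k m : ℕ) : h k m * v k (m + 1) = v k m * h (k + 1) m := by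
    obtain ⟨i, hi⟩ := hsub k m
    have mem (a b : I) : (Icc.convexComb (t k) (t (k + 1)) a, Icc.convexComb (t m) (t (m + 1)) b) ∈
        Icc (t k) (t (k + 1)) ×ˢ Icc (t m) (t (m + 1)) := by
      have aux (l : ℕ) (c : I) : Icc.convexComb (t l) (t (l + 1)) c ∈ Icc (t l) (t (l + 1)) := by
        rw [← uIcc_of_le (htmono l.le_succ), ← Path.range_subpathAux]
        exact mem_range_self c
      exact ⟨aux k a, aux m b⟩
    let K : C(I × I, O i) :=
      ⟨fun p ↦ ⟨H (Icc.convexComb (t k) (t (k + 1)) p.1, Icc.convexComb (t m) (t (m + 1)) p.2),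
        hi (mem p.1 p.2)⟩, by
          refine Continuous.subtype_mk (H.continuous.comp (Continuous.prodMk ?_ ?_)) _ <;>
          · refine Icc.continuous_convexComb_prod.comp
              (continuous_const.prodMk (continuous_const.prodMk ?_))
            fun_prop⟩
    have hb (s : I) : ((H.eval (t k)).subpath (t m) (t (m + 1))) s = K (0, s) := by
      simp [K, subpath_apply, eval_apply]
    have ht (s : I) : ((H.eval (t (k + 1))).subpath (t m) (t (m + 1))) s = K (1, s) := by
      simp [K, subpath_apply, eval_apply]
    have hl (s : I) : ((column (t m)).subpath (t k) (t (k + 1))) s = K (s, 0) := by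
      simp [K, subpath_apply, column_apply]
    have hr (s : I) : ((column (t (m + 1))).subpath (t k) (t (k + 1))) s = K (s, 1) := by
      simp [K, subpath_apply, column_apply]
    simp only [h, v]
    rw [localValue_eq hcompat _ (i := i) (fun s ↦ by rw [hb]; exact (K _).2),
      localValue_eq hcompat _ (i := i) (fun s ↦ by rw [hr]; exact (K _).2),
      localValue_eq hcompat _ (i := i) (fun s ↦ by rw [hl]; exact (K _).2),
      localValue_eq hcompat _ (i := i) (fun s ↦ by rw [ht]; exact (K _).2)]
    exact (g i).map_square K (fun s ↦ Subtype.ext (hb s)) (fun s ↦ Subtype.ext (ht s))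
      (fun s ↦ Subtype.ext (hl s)) (fun s ↦ Subtype.ext (hr s))
  let row (k m : ℕ) : Q := ((List.range m).map (h k)).prod
  have row_succ (k m : ℕ) : row k (m + 1) = row k m * h k m := by
    simp [row, List.range_succ]
  have left_side (k : ℕ) : v k 0 = 1 :=
    value_const _ x fun s ↦ by simp [column, Path.subpath, ht0]
  have right_side (k : ℕ) : v k n = 1 :=
    value_const _ x fun s ↦ by simp [column, Path.subpath, htn]
  have compare (k m : ℕ) : row k m * v k m = v k 0 * row (k + 1) m := by
    induction m with
    | zero => simp [row]
    | succ m ih => rw [row_succ, row_succ, mul_assoc, square, ← mul_assoc, ih, mul_assoc]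
  have row_eq (k : ℕ) : row k n = row 0 n := by
    induction k with
    | zero => rfl
    | succ k ih =>
      have := compare k n
      rw [left_side, right_side, mul_one, one_mul] at this
      rw [← this, ih]
  have last : row n n = 1 := by
    refine List.prod_eq_one fun q hq ↦ ?_
    obtain ⟨m, -, rfl⟩ := List.mem_map.1 hq
    exact value_const _ x fun s ↦ by simp [Path.subpath, htn]
  have first (m : ℕ) : row 0 m = g i ((γ.restrictCodomain hγ).subpath (t 0) (t m)) := by
    induction m with
    | zero => simp [row]
    | succ m ih =>
      rw [row_succ, ih, ← (g i).map_homotopic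
        ⟨Path.Homotopy.subpathTransSubpath (γ.restrictCodomain hγ) (t 0) (t m) (t (m + 1))⟩,
        map_trans]
      congr 1
      have key (s : I) : ((H.eval (t 0)).subpath (t m) (t (m + 1))) s
          = γ (Icc.convexComb (t m) (t (m + 1)) s) := by
        simp [Path.subpath, ht0]
      simp only [h]
      rw [localValue_eq hcompat _ (i := i) (fun s ↦ by rw [key]; exact hγ _)]
      exact (g i).congr fun s ↦ Subtype.ext (key s)
  have total := first n
  rw [← row_eq n, last] at total
  rw [total]
  exact (g i).congr fun s ↦ by simp [Path.subpath, ht0, htn]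

end Glue

end PathCocycle

namespace PathCocycle

open unitInterval Set Bundle

section Algebra

variable {X Y Q R : Type*} [TopologicalSpace X] [TopologicalSpace Y] [Group Q] [Group R]

/-- The image of a cocycle under a homomorphism of the coefficient groups. -/
def mapCoeff (f : PathCocycle X Q) (φ : Q →* R) : PathCocycle X R where
  toFun γ := φ (f γ)
  map_trans' γ δ := by rw [f.map_trans, map_mul]
  map_homotopic' h := by rw [f.map_homotopic h]

@[simp]
theorem mapCoeff_apply (f : PathCocycle X Q) (φ : Q →* R) {x y : X} (γ : Path x y) :
    f.mapCoeff φ γ = φ (f γ) := rfl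

/-- The homomorphism on the fundamental group given by a cocycle. The inverse is there because
the product of `FundamentalGroup` concatenates loops from right to left. -/
def toMonoidHom (f : PathCocycle X Q) (x : X) : FundamentalGroup X x →* Q where
  toFun g := Quotient.lift (fun γ : Path x x ↦ (f γ)⁻¹) (fun _ _ h ↦ by rw [f.map_homotopic h]) g
  map_one' := by
    change (f (Path.refl x))⁻¹ = 1
    simp
  map_mul' g g' := by
    induction g using Quotient.inductionOn with | _ γ => ?_
    induction g' using Quotient.inductionOn with | _ γ' => ?_
    change (f (γ'.trans γ))⁻¹ = (f γ)⁻¹ * (f γ')⁻¹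
    rw [f.map_trans, mul_inv_rev]

theorem toMonoidHom_mk (f : PathCocycle X Q) {x : X} (γ : Path x x) :
    f.toMonoidHom x (FundamentalGroup.fromPath (.mk γ)) = (f γ)⁻¹ := rfl

/-- The universal cocycle of a path connected space, with values in the fundamental group: a path
is closed up to a loop by means of chosen paths from the base point. The path chosen for the base
point itself is null-homotopic, and the inverse is taken as in `PathCocycle.toMonoidHom`. -/
noncomputable def fundamental [PathConnectedSpace X] (x₀ : X) :
    PathCocycle X (FundamentalGroup X x₀) :=
  let η (x : X) : Path.Homotopic.Quotient x₀ x :=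
    (Path.Homotopic.Quotient.mk (PathConnectedSpace.somePath x₀ x₀)).symm.trans
      (.mk (PathConnectedSpace.somePath x₀ x))
  { toFun {x y} γ := (FundamentalGroup.fromPath (((η x).trans (.mk γ)).trans (η y).symm))⁻¹
    map_trans' {x y z} γ δ := by
      rw [← mul_inv_rev]
      congr 1
      rw [FundamentalGroup.mul_def, Path.Homotopic.Quotient.mk_trans]
      generalize Path.Homotopic.Quotient.mk γ = g
      generalize Path.Homotopic.Quotient.mk δ = d
      simp only [FundamentalGroup.fromPath, FundamentalGroup.fromArrow,
        Path.Homotopic.Quotient.trans_assoc]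
      congr 2
      rw [← Path.Homotopic.Quotient.trans_assoc (η y).symm, Path.Homotopic.Quotient.symm_trans,
        Path.Homotopic.Quotient.refl_trans]
    map_homotopic' h := by rw [Path.Homotopic.Quotient.eq.2 h] }

theorem fundamental_apply_loop [PathConnectedSpace X] {x₀ : X} (γ : Path x₀ x₀) :
    fundamental x₀ γ = (FundamentalGroup.fromPath (.mk γ))⁻¹ := by
  simp only [fundamental, Path.Homotopic.Quotient.symm_trans, Path.Homotopic.Quotient.refl_trans]
  congr 2
  rw [← Path.Homotopic.Quotient.mk_refl, ← Path.Homotopic.Quotient.mk_symm, Path.refl_symm,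
    Path.Homotopic.Quotient.mk_refl, Path.Homotopic.Quotient.trans_refl]

theorem map_prod_mul_map_refl_prod (f : PathCocycle (X × Y) Q) {x x' : X} {y y' y'' : Y}
    (α : Path x x') (β : Path y y') (δ : Path y' y'') :
    f (α.prod β) * f ((Path.refl x').prod δ) = f (α.prod (β.trans δ)) := by
  rw [← map_trans, Path.trans_prod_eq_prod_trans]
  exact f.map_homotopic
    ⟨Path.Homotopic.prodHomotopy (Path.Homotopy.transRefl α) (Path.Homotopy.refl _)⟩

theorem map_refl_prod_mul_map_prod (f : PathCocycle (X × Y) Q) {x x' : X} {y y' y'' : Y}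
    (α : Path x x') (β : Path y y') (δ : Path y' y'') :
    f ((Path.refl x).prod β) * f (α.prod δ) = f (α.prod (β.trans δ)) := by
  rw [← map_trans, Path.trans_prod_eq_prod_trans]
  exact f.map_homotopic
    ⟨Path.Homotopic.prodHomotopy (Path.Homotopy.reflTrans α) (Path.Homotopy.refl _)⟩

theorem map_prod_congr (f : PathCocycle (X × Y) Q) {x x' : X} {y y' : Y}
    (α : Path x x') {β δ : Path y y'} (h : β.Homotopic δ) : f (α.prod β) = f (α.prod δ) := by
  obtain ⟨H⟩ := h
  exact f.map_homotopic ⟨Path.Homotopic.prodHomotopy (Path.Homotopy.refl α) H⟩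

end Algebra

end PathCocycle

/-! ### Paths in locally trivial bundles -/

section LocallyTrivial

open unitInterval Set Bundle

/-- `p : E → B` is a locally trivial bundle with fibre `S`. -/
def IsLocallyTrivialBundle (S : Type*) {E B : Type*} [TopologicalSpace S] [TopologicalSpace E]
    [TopologicalSpace B] (p : E → B) : Prop :=
  ∀ b, ∃ e : Trivialization S p, b ∈ e.baseSet

variable {S E B Q : Type*} [TopologicalSpace S] [TopologicalSpace E] [TopologicalSpace B] [Group Q]
  {p : E → B}

namespace Bundle.Trivialization

variable (e : Trivialization S p)

/-- The inverse of a local trivialization, as a continuous map to the total space. -/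
noncomputable def coordMap : C(e.baseSet × S, E) :=
  ⟨fun z ↦ e.sourceHomeomorphBaseSetProd.symm z, by fun_prop⟩

theorem proj_coordMap (z : e.baseSet × S) : p (e.coordMap z) = z.1 := by
  simpa [coordMap, e.sourceHomeomorphBaseSetProd_symm_apply] using
    e.proj_symm_apply' z.1.2

theorem coordMap_coord (x : E) (hx : p x ∈ e.baseSet) :
    e.coordMap (⟨p x, hx⟩, (e x).2) = x := by
  have : e.sourceHomeomorphBaseSetProd ⟨x, e.mem_source.2 hx⟩ = (⟨p x, hx⟩, (e x).2) :=
    e.sourceHomeomorphBaseSetProd_apply _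
  rw [← this]
  exact congrArg Subtype.val (e.sourceHomeomorphBaseSetProd.symm_apply_apply _)

theorem continuous_coord {X : Type*} [TopologicalSpace X] {g : X → E} (hg : Continuous g)
    (h : ∀ x, p (g x) ∈ e.baseSet) : Continuous fun x ↦ (e (g x)).2 :=
  continuous_snd.comp (e.continuousOn_toFun.comp_continuous hg fun x ↦ e.mem_source.2 (h x))

theorem continuous_proj {X : Type*} [TopologicalSpace X] {g : X → E} (hg : Continuous g)
    (h : ∀ x, p (g x) ∈ e.baseSet) : Continuous fun x ↦ p (g x) :=
  e.continuousOn_proj.comp_continuous hg fun x ↦ e.mem_source.2 (h x)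

/-- The projection to the base of a path over the base set of a trivialization. -/
def pathBase {x y : E} (γ : Path x y) (h : ∀ t, p (γ t) ∈ e.baseSet) :
    Path (⟨p x, γ.source ▸ h 0⟩ : e.baseSet) ⟨p y, γ.target ▸ h 1⟩ where
  toFun t := ⟨p (γ t), h t⟩
  continuous_toFun := (e.continuous_proj γ.continuous h).subtype_mk _
  source' := by simp
  target' := by simp

/-- The fibre coordinate of a path over the base set of a trivialization. -/
def pathFibre {x y : E} (γ : Path x y) (h : ∀ t, p (γ t) ∈ e.baseSet) :
    Path (e x).2 (e y).2 where
  toFun t := (e (γ t)).2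
  continuous_toFun := e.continuous_coord γ.continuous h
  source' := by simp
  target' := by simp

theorem cocycle_eq (f : PathCocycle E Q) {x y : E} (γ : Path x y)
    (h : ∀ t, p (γ t) ∈ e.baseSet) :
    f γ = f.comap e.coordMap ((e.pathBase γ h).prod (e.pathFibre γ h)) :=
  f.congr fun t ↦ (e.coordMap_coord (γ t) (h t)).symm

end Bundle.Trivialization

namespace IsLocallyTrivialBundle

theorem continuous (hp : IsLocallyTrivialBundle S p) : Continuous p := by
  rw [continuous_iff_continuousAt]
  intro x
  obtain ⟨e, he⟩ := hp (p x)
  exact e.continuousAt_proj (e.mem_source.2 he)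

theorem surjective [Nonempty S] (hp : IsLocallyTrivialBundle S p) : Function.Surjective p := by
  intro b
  obtain ⟨e, he⟩ := hp b
  exact ⟨e.coordMap (⟨b, he⟩, Classical.arbitrary S), e.proj_coordMap _⟩

variable [PathConnectedSpace S]

theorem exists_path_fibre (hp : IsLocallyTrivialBundle S p) {x y : E} (h : p x = p y) :
    ∃ γ : Path x y, ∀ t, p (γ t) = p x := by
  obtain ⟨e, he⟩ := hp (p x)
  have he' : p y ∈ e.baseSet := h ▸ he
  have hy : e.coordMap (⟨p x, he⟩, (e y).2) = y := by
    have : (⟨p x, he⟩ : e.baseSet) = ⟨p y, he'⟩ := Subtype.ext h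
    rw [this, e.coordMap_coord]
  refine ⟨(((Path.refl _).prod (PathConnectedSpace.somePath (e x).2 (e y).2)).map
    e.coordMap.continuous).cast (e.coordMap_coord x he).symm hy.symm, fun t ↦ ?_⟩
  exact e.proj_coordMap _

/-- Paths in the base lift to the total space, with arbitrary prescribed end points over the given
ones, up to homotopy (here measured by a cocycle). -/
theorem exists_lift (hp : IsLocallyTrivialBundle S p) (f : PathCocycle B Q) {b b' : B}
    (δ : Path b b') : ∀ x y : E, p x = b → p y = b' →
      ∃ γ : Path x y, f.comap ⟨p, hp.continuous⟩ γ = f δ := by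
  have hcont := hp.continuous
  have hsurj := hp.surjective
  choose e he using id hp
  refine Path.induction_of_openCover (O := fun b ↦ (e b).baseSet) (fun b ↦ (e b).open_baseSet)
    (fun b ↦ ⟨b, he b⟩)
    (P := fun {b b'} δ ↦ ∀ x y : E, p x = b → p y = b' →
      ∃ γ : Path x y, f.comap ⟨p, hcont⟩ γ = f δ) ?_ ?_ ?_ δ
  · intro _ _ γ δ h ih x y hx hy
    rw [← f.map_homotopic h]
    exact ih x y hx hy
  · intro _ c _ γ δ hγ hδ x y hx hy
    obtain ⟨z, hz⟩ := hsurj c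
    obtain ⟨γ', h₁⟩ := hγ x z hx hz
    obtain ⟨δ', h₂⟩ := hδ z y hz hy
    exact ⟨γ'.trans δ', by rw [PathCocycle.map_trans, h₁, h₂, f.map_trans]⟩
  · intro i b b' δ hδ x y hx hy
    subst hx hy
    have hx : p x ∈ (e i).baseSet := by simpa using hδ 0
    have hy : p y ∈ (e i).baseSet := by simpa using hδ 1
    refine ⟨(((δ.restrictCodomain hδ).prod
      (PathConnectedSpace.somePath ((e i) x).2 ((e i) y).2)).map (e i).coordMap.continuous).cast
      ((e i).coordMap_coord x hx).symm ((e i).coordMap_coord y hy).symm, ?_⟩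
    exact f.congr fun t ↦ (e i).proj_coordMap _

theorem pathConnectedSpace [PathConnectedSpace B] (hp : IsLocallyTrivialBundle S p) :
    PathConnectedSpace E where
  nonempty := by
    obtain ⟨x, -⟩ := hp.surjective (Classical.arbitrary B)
    exact ⟨x⟩
  joined x y := by
    obtain ⟨γ, -⟩ := hp.exists_lift (Q := Unit) ⟨fun _ ↦ 1, fun _ _ ↦ rfl, fun _ ↦ rfl⟩
      (PathConnectedSpace.somePath (p x) (p y)) x y rfl rfl
    exact ⟨γ⟩

end IsLocallyTrivialBundle

namespace PathCocycle

/-- The subgroup of the values of a cocycle on the loops at `x` inside the fibre of `p`. -/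
def fibreSubgroup (f : PathCocycle E Q) (p : E → B) (x : E) : Subgroup Q where
  carrier := {g | ∃ ε : Path x x, (∀ t, p (ε t) = p x) ∧ f ε = g}
  one_mem' := ⟨Path.refl x, fun _ ↦ rfl, f.map_refl x⟩
  mul_mem' := by
    rintro _ _ ⟨ε, hε, rfl⟩ ⟨ε', hε', rfl⟩
    refine ⟨ε.trans ε', fun t ↦ ?_, f.map_trans _ _⟩
    have : ε.trans ε' t ∈ range (ε.trans ε') := mem_range_self t
    rw [Path.trans_range] at this
    obtain ⟨s, hs⟩ | ⟨s, hs⟩ := this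
    · rw [← hs, hε]
    · rw [← hs, hε']
  inv_mem' := by
    rintro _ ⟨ε, hε, rfl⟩
    exact ⟨ε.symm, fun t ↦ hε _, f.map_symm ε⟩

/-- Conjugation by a path of the total space carries loops in the fibre over its beginning to loops
in the fibre over its end. Over a trivialization this is clear, as the base component of the
conjugated loop is null-homotopic. -/
theorem conj_mem_fibreSubgroup (hp : IsLocallyTrivialBundle S p) (f : PathCocycle E Q) {x y : E}
    (γ : Path x y) : ∀ g ∈ f.fibreSubgroup p x, (f γ)⁻¹ * g * f γ ∈ f.fibreSubgroup p y := by
  have hcont := hp.continuous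
  choose e he using hp
  refine Path.induction_of_openCover (O := fun b ↦ p ⁻¹' (e b).baseSet)
    (fun b ↦ (e b).open_baseSet.preimage hcont) (fun x ↦ ⟨p x, he _⟩)
    (P := fun {x y} γ ↦ ∀ g ∈ f.fibreSubgroup p x, (f γ)⁻¹ * g * f γ ∈ f.fibreSubgroup p y)
    ?_ ?_ ?_ γ
  · intro _ _ γ δ h ih
    rwa [← f.map_homotopic h]
  · intro _ _ _ γ δ hγ hδ g hg
    have := hδ _ (hγ g hg)
    rw [f.map_trans]
    simpa only [mul_inv_rev, mul_assoc] using this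
  · rintro i x y γ hγ _ ⟨ε, hε, rfl⟩
    have hx : p x ∈ (e i).baseSet := by simpa using hγ 0
    have hy : p y ∈ (e i).baseSet := by simpa using hγ 1
    have hε' : ∀ t, p (ε t) ∈ (e i).baseSet := fun t ↦ hε t ▸ hx
    let u := (e i).pathFibre γ hγ
    let w := (e i).pathFibre ε hε'
    refine ⟨(((Path.refl _).prod (u.symm.trans (w.trans u))).map
      (e i).coordMap.continuous).cast ((e i).coordMap_coord y hy).symm
      ((e i).coordMap_coord y hy).symm, fun t ↦ (e i).proj_coordMap _, ?_⟩
    have h₁ : f ε = f.comap (e i).coordMap ((Path.refl ⟨p x, hx⟩).prod w) :=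
      f.congr fun t ↦ by
        rw [← (e i).coordMap_coord (ε t) (hε' t)]
        exact congrArg (e i).coordMap (Prod.ext (Subtype.ext (hε t)) rfl)
    rw [map_cast, mul_assoc, eq_inv_mul_iff_mul_eq, h₁, (e i).cocycle_eq f γ hγ, ← comap_apply,
      map_prod_mul_map_refl_prod, map_refl_prod_mul_map_prod]
    refine map_prod_congr _ _ ?_
    rw [← Path.Homotopic.Quotient.eq]
    simp only [Path.Homotopic.Quotient.mk_trans, Path.Homotopic.Quotient.mk_symm]
    rw [← Path.Homotopic.Quotient.trans_assoc, Path.Homotopic.Quotient.trans_symm,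
      Path.Homotopic.Quotient.refl_trans]

/-- A cocycle that is trivial on the loops in the fibres is cohomologous to one that is trivial on
all paths in the fibres. -/
theorem exists_twist_eq_one [PathConnectedSpace S] (hp : IsLocallyTrivialBundle S p)
    (f : PathCocycle E Q) (hf : ∀ {x : E} (ε : Path x x), (∀ t, p (ε t) = p x) → f ε = 1) :
    ∃ c : E → Q, ∀ {x y : E} (γ : Path x y), (∀ t, p (γ t) = p x) → f.twist c γ = 1 := by
  choose s hs using hp.surjective
  choose κ hκ using fun x : E ↦ hp.exists_path_fibre (x := x) (y := s (p x)) (hs _).symm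
  refine ⟨fun x ↦ (f (κ x))⁻¹, fun {x y} γ hγ ↦ ?_⟩
  have hxy : p y = p x := by simpa using hγ 1
  have hloop := hf (((κ x).symm.trans (γ.trans (κ y))).cast rfl (by rw [hxy])) fun t ↦ by
    rw [hs]
    have : ((κ x).symm.trans (γ.trans (κ y))) t ∈ range ((κ x).symm.trans (γ.trans (κ y))) :=
      mem_range_self t
    rw [Path.trans_range, Path.trans_range, Path.symm_range] at this
    change p (((κ x).symm.trans (γ.trans (κ y))) t) = _
    obtain ⟨r, hr⟩ | ⟨r, hr⟩ | ⟨r, hr⟩ := this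
    · rw [← hr, hκ]
    · rw [← hr, hγ]
    · rw [← hr, hκ, hxy]
  rw [map_cast, map_trans, map_trans, map_symm] at hloop
  simpa [mul_assoc] using hloop

/-- Over the base set of a trivialization, a cocycle that is trivial on paths in the fibres is
determined by its values on a section. -/
theorem eq_map_section [PathConnectedSpace S] (f : PathCocycle E Q)
    (hf : ∀ {x y : E} (γ : Path x y), (∀ t, p (γ t) = p x) → f γ = 1)
    (e : Trivialization S p) (u : S) {x y : E} (γ : Path x y) (hγ : ∀ t, p (γ t) ∈ e.baseSet) :
    f γ = f.comap e.coordMap ((e.pathBase γ hγ).prod (Path.refl u)) := by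
  have fibre (b : e.baseSet) {v v' : S} (w : Path v v') :
      f.comap e.coordMap ((Path.refl b).prod w) = 1 :=
    hf _ fun t ↦ by
      rw [e.proj_coordMap]
      exact e.proj_coordMap _
  let w := PathConnectedSpace.somePath u (e x).2
  rw [e.cocycle_eq f γ hγ]
  set g := f.comap e.coordMap
  calc g ((e.pathBase γ hγ).prod (e.pathFibre γ hγ))
      = g ((Path.refl (⟨p x, γ.source ▸ hγ 0⟩ : e.baseSet)).prod w) *
          g ((e.pathBase γ hγ).prod (e.pathFibre γ hγ)) := by
        rw [fibre, one_mul]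
    _ = g ((e.pathBase γ hγ).prod ((Path.refl u).trans (w.trans (e.pathFibre γ hγ)))) := by
        rw [map_refl_prod_mul_map_prod]
        exact map_prod_congr _ _ (Path.Homotopic.symm ⟨Path.Homotopy.reflTrans _⟩)
    _ = _ := by rw [← map_prod_mul_map_refl_prod, fibre, mul_one]

end PathCocycle

end LocallyTrivial

/-! ### The fundamental group of the base in a union of two disk bundles -/

section Union

open unitInterval Set Bundle

variable {S M E F N : Type*} [TopologicalSpace S] [TopologicalSpace M] [TopologicalSpace E]
  [TopologicalSpace F] [TopologicalSpace N]

/-- Let the simply connected space `M` be the union of open sets `A` and `B` with maps `a : A → F`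
and `b : B → N` which on `A ∩ B` factor through the locally trivial bundles `p : E → F` and
`q : E → N`. If `ι : F → M` is a section of `a`, then every loop in `F` comes from a loop in a
fibre of `q`.

The values of the given cocycle on the loops in this fibre form a normal subgroup. Modulo this
subgroup, the cocycle pulled back to `E` is trivial on the fibres of `q`, hence it descends to `N`
locally, and the van Kampen theorem applies. -/
theorem PathCocycle.mem_fibreSubgroup_of_union {G : Type*} [Group G] [PathConnectedSpace S]
    [PathConnectedSpace F] [SimplyConnectedSpace M]
    {A B : Set M} (hA : IsOpen A) (hB : IsOpen B) (hAB : ∀ x, x ∈ A ∨ x ∈ B)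
    {p : E → F} (hp : IsLocallyTrivialBundle S p) {q : E → N} (hq : IsLocallyTrivialBundle S q)
    (a : C(A, F)) (b : C(B, N)) (r : C(↥(A ∩ B), E))
    (ha : ∀ x : ↥(A ∩ B), p (r x) = a ⟨x, x.2.1⟩) (hb : ∀ x : ↥(A ∩ B), q (r x) = b ⟨x, x.2.2⟩)
    (ι : C(F, M)) (hι : ∀ x, ι x ∈ A) (hιa : ∀ x, a ⟨ι x, hι x⟩ = x)
    (f : PathCocycle F G) (x₀ : E) (hf : ∀ g, ∃ δ : Path (p x₀) (p x₀), f δ = g)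
    (δ : Path (p x₀) (p x₀)) :
    f δ ∈ (f.comap ⟨p, hp.continuous⟩).fibreSubgroup q x₀ := by
  have := hp.pathConnectedSpace
  set h := f.comap ⟨p, hp.continuous⟩
  set C := h.fibreSubgroup q x₀
  -- A loop of `F` lifts to a loop of `E`, which conjugates fibre loops to fibre loops.
  have : C.Normal := by
    refine ⟨fun c hc g ↦ ?_⟩
    obtain ⟨δ, hδ⟩ := hf g⁻¹
    obtain ⟨γ, hγ⟩ := hp.exists_lift f δ x₀ x₀ rfl rfl
    have key := conj_mem_fibreSubgroup hq h γ c hc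
    rwa [hγ, hδ, inv_inv] at key
  let φ := QuotientGroup.mk' C
  let k := h.mapCoeff φ
  have hk {x : E} (ε : Path x x) (hε : ∀ t, q (ε t) = q x) : k ε = 1 := by
    let γ := PathConnectedSpace.somePath x x₀
    have key : (k γ)⁻¹ * k ε * k γ = 1 := by
      have := conj_mem_fibreSubgroup hq h γ (h ε) ⟨ε, hε, rfl⟩
      simpa [φ, k] using (QuotientGroup.eq_one_iff _).2 this
    rw [mul_assoc, inv_mul_eq_one] at key
    exact mul_right_cancel (b := k γ) (by rw [← key, one_mul])
  obtain ⟨c, hc⟩ := exists_twist_eq_one hq k hk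
  let u : S := Classical.arbitrary S
  choose e he using hq
  classical
  -- The cover of `M` consists of `A` and of the parts of `B` over trivializing subsets of `N`.
  let O : Option N → Set M := fun i ↦ i.elim A fun y ↦ Subtype.val '' (b ⁻¹' (e y).baseSet)
  have hO : ∀ i, IsOpen (O i) := by
    rintro (_ | y)
    · exact hA
    · exact hB.isOpenMap_subtype_val _ ((e y).open_baseSet.preimage b.continuous)
  have hcov : ∀ x, ∃ i, x ∈ O i := by
    intro x
    obtain hx | hx := hAB x
    · exact ⟨none, hx⟩
    · exact ⟨some (b ⟨x, hx⟩), ⟨⟨x, hx⟩, he _, rfl⟩⟩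
  have memB {y : N} {x : M} (hx : x ∈ O (some y)) : x ∈ B := by
    obtain ⟨z, -, rfl⟩ := hx
    exact z.2
  have memBase {y : N} {x : M} (hx : x ∈ O (some y)) : b ⟨x, memB hx⟩ ∈ (e y).baseSet := by
    obtain ⟨z, hz, rfl⟩ := hx
    exact hz
  let sec (y : N) : C(O (some y), E) :=
    ⟨fun x ↦ (e y).coordMap (⟨b ⟨x, memB x.2⟩, memBase x.2⟩, u), by fun_prop⟩
  -- The function in the twist has to be defined on all of `A`; its values outside `B` are
  -- immaterial.
  let g : ∀ i, PathCocycle (O i) (G ⧸ C)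
    | none => ((f.mapCoeff φ).comap a).twist fun x ↦ if hx : x.1 ∈ B then c (r ⟨x, x.2, hx⟩) else 1
    | some y => (k.twist c).comap (sec y)
  have hsec (y : N) {x x' : M} (γ : Path x x') (hγ : ∀ t, γ t ∈ O (some y)) (η : C(I, E))
      (hη : ∀ t, q (η t) = b ⟨γ t, memB (hγ t)⟩) :
      (k.twist c) (⟨η, rfl, rfl⟩ : Path (η 0) (η 1)) = g (some y) (γ.restrictCodomain hγ) := by
    rw [eq_map_section _ hc (e y) u _ fun t ↦ by
      change q (η t) ∈ _
      rw [hη]; exact memBase (hγ t)]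
    exact (k.twist c).congr fun t ↦ congrArg (e y).coordMap (Prod.ext (Subtype.ext (hη t)) rfl)
  have hcompat₁ (y : N) {x x' : M} (γ : Path x x') (hγA : ∀ t, γ t ∈ O none)
      (hγ : ∀ t, γ t ∈ O (some y)) :
      g none (γ.restrictCodomain hγA) = g (some y) (γ.restrictCodomain hγ) := by
    let η : C(I, E) := ⟨fun t ↦ r ⟨γ t, hγA t, memB (hγ t)⟩, by fun_prop⟩
    rw [← hsec y γ hγ η fun t ↦ hb _]
    have hx : x ∈ B := γ.source ▸ memB (hγ 0)
    have hx' : x' ∈ B := γ.target ▸ memB (hγ 1)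
    have hxA : x ∈ A := γ.source ▸ hγA 0
    have hxA' : x' ∈ A := γ.target ▸ hγA 1
    have h₀ : r ⟨x, hxA, hx⟩ = η 0 := congrArg r (Subtype.ext γ.source.symm)
    have h₁ : r ⟨x', hxA', hx'⟩ = η 1 := congrArg r (Subtype.ext γ.target.symm)
    change (if hx : x ∈ B then c (r ⟨x, hxA, hx⟩) else 1) *
      ((f.mapCoeff φ).comap a) (γ.restrictCodomain hγA) *
      (if hx : x' ∈ B then c (r ⟨x', hxA', hx⟩) else 1)⁻¹ = c (η 0) * k _ * (c (η 1))⁻¹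
    rw [dif_pos hx, dif_pos hx', h₀, h₁]
    congr 2
    exact (f.mapCoeff φ).congr fun t ↦ (ha ⟨γ t, hγA t, memB (hγ t)⟩).symm
  have hcompat : ∀ (i j : Option N) {x y : M} (γ : Path x y) (hi : ∀ t, γ t ∈ O i)
      (hj : ∀ t, γ t ∈ O j), g i (γ.restrictCodomain hi) = g j (γ.restrictCodomain hj) := by
    rintro (_ | y) (_ | z) x x' γ hi hj
    · rfl
    · exact hcompat₁ z γ hi hj
    · exact (hcompat₁ y γ hj hi).symm
    · let η : C(I, E) := ⟨fun t ↦ sec y ⟨γ t, hi t⟩, by fun_prop⟩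
      have hη (t : I) : q (η t) = b ⟨γ t, memB (hi t)⟩ := (e y).proj_coordMap _
      rw [← hsec y γ hi η hη, ← hsec z γ hj η hη]
  have hγ (t : I) : δ.map ι.continuous t ∈ O none := hι _
  have key := eq_one_of_homotopic_refl hcompat hO hcov hγ
    (SimplyConnectedSpace.paths_homotopic _ _)
  have hδ : (f.mapCoeff φ).comap a ((δ.map ι.continuous).restrictCodomain hγ) = φ (f δ) :=
    (f.mapCoeff φ).congr fun t ↦ hιa _
  change _ * (f.mapCoeff φ).comap a ((δ.map ι.continuous).restrictCodomain hγ) * _ = 1 at key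
  rw [hδ, mul_inv_eq_one, mul_eq_left] at key
  exact (QuotientGroup.eq_one_iff _).1 key

theorem isCyclic_fundamentalGroup_circle (u : Circle) : IsCyclic (FundamentalGroup Circle u) := by
  obtain ⟨θ, hθ⟩ := Circle.isAddQuotientCoveringMap_exp.surjective u
  let e := Circle.isAddQuotientCoveringMap_exp.fundamentalGroupEquiv (x := u) ⟨θ, hθ⟩
  have h : IsCyclic (Multiplicative (AddSubgroup.zmultiples (2 * Real.pi))) := inferInstance
  exact (e.trans MulOpposite.opMulEquiv.symm).isCyclic.2 h

/-- In the situation of `PathCocycle.mem_fibreSubgroup_of_union`, if the bundles are circle bundles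
and every element of `G` is the value of a loop, then `G` is an image of the fundamental group of
the circle. -/
theorem PathCocycle.isCyclic_of_union {G : Type*} [Group G]
    [PathConnectedSpace F] [SimplyConnectedSpace M]
    {A B : Set M} (hA : IsOpen A) (hB : IsOpen B) (hAB : ∀ x, x ∈ A ∨ x ∈ B)
    {p : E → F} (hp : IsLocallyTrivialBundle Circle p)
    {q : E → N} (hq : IsLocallyTrivialBundle Circle q)
    (a : C(A, F)) (b : C(B, N)) (r : C(↥(A ∩ B), E))
    (ha : ∀ x : ↥(A ∩ B), p (r x) = a ⟨x, x.2.1⟩) (hb : ∀ x : ↥(A ∩ B), q (r x) = b ⟨x, x.2.2⟩)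
    (ι : C(F, M)) (hι : ∀ x, ι x ∈ A) (hιa : ∀ x, a ⟨ι x, hι x⟩ = x)
    (f : PathCocycle F G) (x₀ : E) (hf : ∀ g, ∃ δ : Path (p x₀) (p x₀), f δ = g) :
    IsCyclic G := by
  obtain ⟨e, he⟩ := id hq (q x₀)
  let j : C(Circle, E) := ⟨fun u ↦ e.coordMap (⟨q x₀, he⟩, u), by fun_prop⟩
  let χ := ((f.comap ⟨p, hp.continuous⟩).comap j).toMonoidHom (e x₀).2
  have hχ : Function.Surjective χ := by
    intro g
    obtain ⟨δ, hδ⟩ := hf g⁻¹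
    obtain ⟨ε, hε, hεg⟩ := PathCocycle.mem_fibreSubgroup_of_union hA hB hAB hp hq a b r ha hb ι hι
      hιa f x₀ hf δ
    have hε' (t) : q (ε t) ∈ e.baseSet := hε t ▸ he
    refine ⟨FundamentalGroup.fromPath (.mk (e.pathFibre ε hε')), ?_⟩
    rw [PathCocycle.toMonoidHom_mk, inv_eq_iff_eq_inv, ← hδ, ← hεg]
    refine (f.comap ⟨p, hp.continuous⟩).congr (γ := (e.pathFibre ε hε').map j.continuous)
      fun t ↦ ?_
    rw [← e.coordMap_coord (ε t) (hε' t)]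
    exact congrArg e.coordMap (Prod.ext (Subtype.ext (hε t).symm) rfl)
  have := isCyclic_fundamentalGroup_circle (e x₀).2
  exact isCyclic_of_surjective χ hχ

/-- Let the simply connected space `M` be the union of open sets `A` and `B` with maps `a : A → F`
and `b : B → N` which on `A ∩ B` factor through circle bundles `p : E → F` and `q : E → N`. If `F`
is path connected and `a` has a section on `F`, then the fundamental group of `F` is cyclic. -/
theorem isCyclic_fundamentalGroup_of_union
    [PathConnectedSpace F] [SimplyConnectedSpace M]
    {A B : Set M} (hA : IsOpen A) (hB : IsOpen B) (hAB : ∀ x, x ∈ A ∨ x ∈ B)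
    {p : E → F} (hp : IsLocallyTrivialBundle Circle p)
    {q : E → N} (hq : IsLocallyTrivialBundle Circle q)
    (a : C(A, F)) (b : C(B, N)) (r : C(↥(A ∩ B), E))
    (ha : ∀ x : ↥(A ∩ B), p (r x) = a ⟨x, x.2.1⟩) (hb : ∀ x : ↥(A ∩ B), q (r x) = b ⟨x, x.2.2⟩)
    (ι : C(F, M)) (hι : ∀ x, ι x ∈ A) (hιa : ∀ x, a ⟨ι x, hι x⟩ = x) (x : F) :
    IsCyclic (FundamentalGroup F x) := by
  obtain ⟨x₀, rfl⟩ := hp.surjective x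
  refine (PathCocycle.fundamental (p x₀)).isCyclic_of_union hA hB hAB hp hq a b r ha hb ι hι hιa x₀
    fun g ↦ ?_
  obtain ⟨δ, hδ⟩ := Path.Homotopic.Quotient.mk_surjective (g⁻¹).toPath
  refine ⟨δ, ?_⟩
  rw [PathCocycle.fundamental_apply_loop, hδ]
  exact inv_inv g

end Union

/-! ### Circle bundles of plane bundles -/

section PlaneBundles

open Set Bundle Topology

variable {B : Type*} [TopologicalSpace B] {V : B → Type*} [TopologicalSpace (TotalSpace Plane V)]
  [∀ x, NormedAddCommGroup (V x)] [∀ x, InnerProductSpace ℝ (V x)]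
  [FiberBundle Plane V] [VectorBundle ℝ Plane V]

/-- The identification of the standard plane with `ℂ`. -/
noncomputable def planeIsometry : Plane ≃ₗᵢ[ℝ] ℂ := Complex.orthonormalBasisOneI.repr.symm

/-- The angular coordinate of a nonzero vector of the plane; `1` for the zero vector. -/
noncomputable def planeAngle (v : Plane) : Circle :=
  if h : v = 0 then 1 else
    ⟨planeIsometry (‖v‖⁻¹ • v), by
      refine mem_sphere_zero_iff_norm.2 ?_
      rw [LinearIsometryEquiv.norm_map, norm_smul, norm_inv, norm_norm,
        inv_mul_cancel₀ (norm_ne_zero_iff.2 h)]⟩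

/-- The inclusion of the circle in the plane. -/
noncomputable def circleToPlane (z : Circle) : Plane := planeIsometry.symm (z : ℂ)

theorem norm_circleToPlane (z : Circle) : ‖circleToPlane z‖ = 1 := by
  rw [circleToPlane, LinearIsometryEquiv.norm_map, Circle.norm_coe]

theorem circleToPlane_ne_zero (z : Circle) : circleToPlane z ≠ 0 := by
  rw [← norm_ne_zero_iff, norm_circleToPlane]
  exact one_ne_zero

theorem continuous_circleToPlane : Continuous circleToPlane :=
  planeIsometry.symm.continuous.comp continuous_subtype_val

theorem coe_planeAngle {v : Plane} (h : v ≠ 0) :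
    (planeAngle v : ℂ) = planeIsometry (‖v‖⁻¹ • v) :=
  congrArg Subtype.val (dif_neg h)

theorem circleToPlane_planeAngle {v : Plane} (h : v ≠ 0) :
    circleToPlane (planeAngle v) = ‖v‖⁻¹ • v := by
  rw [circleToPlane, coe_planeAngle h, LinearIsometryEquiv.symm_apply_apply]

theorem planeAngle_smul_circleToPlane (z : Circle) {c : ℝ} (hc : 0 < c) :
    planeAngle (c • circleToPlane z) = z := by
  have h : c • circleToPlane z ≠ 0 := smul_ne_zero hc.ne' (circleToPlane_ne_zero z)
  apply Circle.ext
  rw [coe_planeAngle h, norm_smul, norm_circleToPlane, Real.norm_of_nonneg hc.le, mul_one,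
    smul_smul, inv_mul_cancel₀ hc.ne', one_smul, circleToPlane,
    LinearIsometryEquiv.apply_symm_apply]

theorem continuousOn_planeAngle : ContinuousOn planeAngle {0}ᶜ := by
  refine (IsInducing.subtypeVal.continuousOn_iff).2 ?_
  have : ContinuousOn (fun v : Plane ↦ planeIsometry (‖v‖⁻¹ • v)) {0}ᶜ :=
    planeIsometry.continuous.comp_continuousOn
      ((continuousOn_id.norm.inv₀ fun v hv ↦ norm_ne_zero_iff.2 hv).smul continuousOn_id)
  exact this.congr fun v hv ↦ coe_planeAngle hv

theorem continuous_norm_totalSpace [IsContinuousRiemannianBundle Plane V] :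
    Continuous fun v : TotalSpace Plane V ↦ ‖v.2‖ := by
  have h : Continuous fun v : TotalSpace Plane V ↦ (inner ℝ v.2 v.2 : ℝ) :=
    Continuous.inner_bundle (F := Plane) (b := fun v : TotalSpace Plane V ↦ v.1) continuous_id
      continuous_id
  have h' : (fun v : TotalSpace Plane V ↦ ‖v.2‖) = fun v ↦ √(inner ℝ v.2 v.2) := by
    ext v
    rw [real_inner_self_eq_norm_sq, Real.sqrt_sq (norm_nonneg _)]
  rw [h']
  exact h.sqrt

theorem exists_norm_eq_one (V : B → Type*) [TopologicalSpace (TotalSpace Plane V)]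
    [∀ x, NormedAddCommGroup (V x)] [∀ x, InnerProductSpace ℝ (V x)]
    [FiberBundle Plane V] [VectorBundle ℝ Plane V] (b : B) : ∃ v : V b, ‖v‖ = 1 := by
  have e := (trivializationAt Plane V b).continuousLinearEquivAt ℝ b
    (FiberBundle.mem_baseSet_trivializationAt' b)
  have : Nontrivial (V b) := e.toEquiv.nontrivial
  exact exists_norm_eq (V b) zero_le_one

open Classical in
/-- The radial projection of a plane bundle to its unit circle bundle, continuous away from the zero
section. The zero vectors are sent to arbitrary unit vectors over the same points. -/
noncomputable def radialProjection (v : TotalSpace Plane V) : unitCircleBundle V :=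
  if h : v.2 = 0 then
    ⟨⟨v.1, (exists_norm_eq_one V v.1).choose⟩, (exists_norm_eq_one V v.1).choose_spec⟩
  else ⟨⟨v.1, ‖v.2‖⁻¹ • v.2⟩, by simp [unitCircleBundle, norm_smul, h]⟩

@[simp]
theorem proj_radialProjection (v : TotalSpace Plane V) : (radialProjection v).1.proj = v.proj := by
  unfold radialProjection
  split_ifs <;> rfl

theorem coe_radialProjection {v : TotalSpace Plane V} (h : v.2 ≠ 0) :
    (radialProjection v : TotalSpace Plane V) = ⟨v.1, ‖v.2‖⁻¹ • v.2⟩ := by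
  simp [radialProjection, h]

theorem radialProjection_smul (v : unitCircleBundle V) {c : ℝ} (hc : 0 < c) :
    radialProjection (⟨v.1.1, c • v.1.2⟩ : TotalSpace Plane V) = v := by
  have hv : ‖v.1.2‖ = 1 := v.2
  have h : c • v.1.2 ≠ 0 := smul_ne_zero hc.ne' (by rw [← norm_ne_zero_iff, hv]; exact one_ne_zero)
  apply Subtype.ext
  rw [coe_radialProjection h]
  simp [norm_smul, hv, abs_of_pos hc, smul_smul, hc.ne']

theorem radialProjection_coe (v : unitCircleBundle V) : radialProjection v.1 = v := by
  simpa using radialProjection_smul v one_pos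

theorem continuousOn_radialProjection [IsContinuousRiemannianBundle Plane V] :
    ContinuousOn (radialProjection (V := V)) {v | v.2 ≠ 0} := by
  refine (IsInducing.subtypeVal.continuousOn_iff).2 ?_
  have : ContinuousOn (fun v : TotalSpace Plane V ↦
      (⟨v.1, ‖v.2‖⁻¹ • v.2⟩ : TotalSpace Plane V)) {v | v.2 ≠ 0} := by
    intro v hv
    refine ContinuousAt.continuousWithinAt ?_
    rw [FiberBundle.continuousAt_totalSpace]
    refine ⟨(FiberBundle.continuous_proj Plane V).continuousAt, ?_⟩
    set e := trivializationAt Plane V v.1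
    have hmem : v.1 ∈ e.baseSet := FiberBundle.mem_baseSet_trivializationAt' v.1
    have hv' : v ∈ e.source := e.mem_source.2 hmem
    have h₁ : ContinuousAt (fun w : TotalSpace Plane V ↦ ‖w.2‖⁻¹ • (e w).2) v :=
      (continuous_norm_totalSpace.continuousAt.inv₀ (norm_ne_zero_iff.2 hv)).smul
        (continuous_snd.continuousAt.comp (e.continuousAt hv'))
    refine h₁.congr ?_
    filter_upwards [e.open_source.mem_nhds hv'] with w hw
    exact ((e.linear ℝ (e.mem_source.1 hw)).map_smul _ _).symm
  exact this.congr fun v hv ↦ coe_radialProjection hv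

/-- The trivialization of the unit circle bundle induced by a trivialization of a plane bundle; the
latter is not required to be isometric on the fibres. -/
noncomputable def circleTrivialization [IsContinuousRiemannianBundle Plane V]
    (e : Trivialization Plane (π Plane V)) [e.IsLinear ℝ] :
    Trivialization Circle (fun v : unitCircleBundle V ↦ v.1.proj) :=
  have e_ne_zero {v : unitCircleBundle V} (hv : v.1.proj ∈ e.baseSet) : (e v.1).2 ≠ 0 := by
    intro h
    have h₁ := (e.linearEquivAt ℝ _ hv).map_eq_zero_iff.1
      (show e.linearEquivAt ℝ _ hv v.1.2 = 0 from h)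
    have h₂ : ‖v.1.2‖ = 1 := v.2
    simp [h₁] at h₂
  have symm_ne_zero {b : B} (hb : b ∈ e.baseSet) (z : Circle) :
      (e.toOpenPartialHomeomorph.symm (b, circleToPlane z)).2 ≠ 0 := by
    intro h
    have h₁ := e.apply_symm_apply' (x := circleToPlane z) hb
    have h₂ := e.proj_symm_apply' (x := circleToPlane z) hb
    set w := e.toOpenPartialHomeomorph.symm (b, circleToPlane z)
    have hw : w.1 ∈ e.baseSet := h₂ ▸ hb
    have h₃ : (e w).2 = 0 := by
      have : (e ⟨w.1, w.2⟩).2 = 0 := by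
        rw [h]
        exact (e.linear ℝ hw).map_zero
      exact this
    rw [h₁] at h₃
    exact circleToPlane_ne_zero z h₃
  { toFun v := (v.1.proj, planeAngle (e v.1).2)
    invFun x := radialProjection (e.toOpenPartialHomeomorph.symm (x.1, circleToPlane x.2))
    source := {v | v.1.proj ∈ e.baseSet}
    target := e.baseSet ×ˢ univ
    baseSet := e.baseSet
    open_baseSet := e.open_baseSet
    source_eq := rfl
    target_eq := rfl
    proj_toFun _ _ := rfl
    map_source' v hv := ⟨hv, mem_univ _⟩
    map_target' x hx := by
      have h := e.proj_symm_apply' (x := circleToPlane x.2) hx.1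
      change (radialProjection _).1.proj ∈ e.baseSet
      rw [proj_radialProjection, h]
      exact hx.1
    left_inv' v hv := by
      have hv : v.1.proj ∈ e.baseSet := hv
      have h : e.toOpenPartialHomeomorph.symm (v.1.proj, ‖(e v.1).2‖⁻¹ • (e v.1).2) =
          ⟨v.1.1, ‖(e v.1).2‖⁻¹ • v.1.2⟩ := by
        rw [← e.symm_apply_apply (x := ⟨v.1.1, ‖(e v.1).2‖⁻¹ • v.1.2⟩) (e.mem_source.2 hv)]
        congr 1
        refine Prod.ext (e.coe_fst' (x := ⟨v.1.1, ‖(e v.1).2‖⁻¹ • v.1.2⟩) hv).symm ?_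
        exact ((e.linear ℝ hv).map_smul _ _).symm
      change radialProjection (e.toOpenPartialHomeomorph.symm
        (v.1.proj, circleToPlane (planeAngle (e v.1).2))) = v
      rw [circleToPlane_planeAngle (e_ne_zero hv), h]
      exact radialProjection_smul v (inv_pos.2 (norm_pos_iff.2 (e_ne_zero hv)))
    right_inv' x hx := by
      obtain ⟨b, z⟩ := x
      have hb : b ∈ e.baseSet := hx.1
      have h₁ := e.apply_symm_apply' (x := circleToPlane z) hb
      have h₂ := e.proj_symm_apply' (x := circleToPlane z) hb
      have h₃ := symm_ne_zero hb z
      refine Prod.ext ((proj_radialProjection _).trans h₂) ?_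
      change planeAngle (e (radialProjection
        (e.toOpenPartialHomeomorph.symm (b, circleToPlane z))).1).2 = z
      set w := e.toOpenPartialHomeomorph.symm (b, circleToPlane z)
      have hw : w.1 ∈ e.baseSet := h₂ ▸ hb
      have h₄ : (e (⟨w.1, ‖w.2‖⁻¹ • w.2⟩ : TotalSpace Plane V)).2 = ‖w.2‖⁻¹ • (e w).2 :=
        (e.linear ℝ hw).map_smul _ _
      rw [coe_radialProjection h₃, h₄, h₁]
      exact planeAngle_smul_circleToPlane z (inv_pos.2 (norm_pos_iff.2 h₃))
    open_source := e.open_baseSet.preimage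
      ((FiberBundle.continuous_proj Plane V).comp continuous_subtype_val)
    open_target := e.open_baseSet.prod isOpen_univ
    continuousOn_toFun := by
      refine ContinuousOn.prodMk
        ((FiberBundle.continuous_proj Plane V).comp continuous_subtype_val).continuousOn ?_
      refine continuousOn_planeAngle.comp (continuous_snd.comp_continuousOn
        (e.continuousOn_toFun.comp continuous_subtype_val.continuousOn fun v hv ↦ ?_)) fun v hv ↦ ?_
      · exact e.mem_source.2 hv
      · exact e_ne_zero hv
    continuousOn_invFun := by
      refine continuousOn_radialProjection.comp (e.continuousOn_invFun.comp
        (continuous_fst.prodMk (continuous_circleToPlane.comp continuous_snd)).continuousOn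
        fun x hx ↦ ?_) fun x hx ↦ ?_
      · exact e.mem_target.2 hx.1
      · exact symm_ne_zero hx.1 x.2 }

theorem isLocallyTrivialBundle_unitCircleBundle [IsContinuousRiemannianBundle Plane V] :
    IsLocallyTrivialBundle Circle (fun v : unitCircleBundle V ↦ v.1.proj) :=
  fun b ↦ ⟨circleTrivialization (trivializationAt Plane V b),
    FiberBundle.mem_baseSet_trivializationAt' b⟩

end PlaneBundles

/-! ### Unions of two disk bundles -/

section Decomposition

open Set Bundle Topology

/-- A closed embedding of a subset has an inverse that is continuous on its image. -/
theorem Topology.IsClosedEmbedding.exists_continuousOn_leftInverse {X Y : Type*}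
    [TopologicalSpace X] [TopologicalSpace Y] [Nonempty X] {D : Set X} {φ : X → Y}
    (h : IsClosedEmbedding (D.domRestrict φ)) :
    ∃ L : Y → X, ContinuousOn L (φ '' D) ∧ ∀ v ∈ D, L (φ v) = v := by
  have hinj : InjOn φ D := injOn_iff_injective.2 h.injective
  have hleft : ∀ v ∈ D, Function.invFunOn φ D (φ v) = v := fun v hv ↦ hinj.leftInvOn_invFunOn hv
  refine ⟨Function.invFunOn φ D, ?_, hleft⟩
  rw [continuousOn_iff_continuous_domRestrict]
  let e := h.isEmbedding.toHomeomorph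
  have hmem (y : φ '' D) : y.1 ∈ range (D.domRestrict φ) := by
    obtain ⟨-, v, hv, rfl⟩ := y
    exact ⟨⟨v, hv⟩, rfl⟩
  have hcont : Continuous fun y : φ '' D ↦ (e.symm ⟨y.1, hmem y⟩ : X) := by fun_prop
  refine hcont.congr ?_
  rintro ⟨-, v, hv, rfl⟩
  have : e.symm ⟨φ v, hmem ⟨φ v, v, hv, rfl⟩⟩ = ⟨v, hv⟩ := by
    rw [Homeomorph.symm_apply_eq]
    rfl
  rw [this]
  exact (hleft v hv).symm

variable {F : Type*} [TopologicalSpace F] {V : F → Type*} [TopologicalSpace (TotalSpace Plane V)]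
  [∀ x, NormedAddCommGroup (V x)] [∀ x, InnerProductSpace ℝ (V x)]
  [FiberBundle Plane V] [VectorBundle ℝ Plane V] [IsContinuousRiemannianBundle Plane V]
  {N : Type*} [TopologicalSpace N] {W : N → Type*} [TopologicalSpace (TotalSpace Plane W)]
  [∀ x, NormedAddCommGroup (W x)] [∀ x, InnerProductSpace ℝ (W x)]
  [FiberBundle Plane W] [VectorBundle ℝ Plane W] [IsContinuousRiemannianBundle Plane W]
  {M : Type*} [TopologicalSpace M] [SimplyConnectedSpace M]
  {φ : TotalSpace Plane V → M} {ψ : TotalSpace Plane W → M}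

theorem IsDiskBundleDecomposition.symm {F N M : Type*} {V : F → Type*} {W : N → Type*}
    [∀ x, NormedAddCommGroup (V x)] [∀ x, NormedAddCommGroup (W x)]
    {φ : TotalSpace Plane V → M} {ψ : TotalSpace Plane W → M}
    (h : IsDiskBundleDecomposition φ ψ) : IsDiskBundleDecomposition ψ φ where
  cover := by rw [union_comm]; exact h.cover
  inter_eq_left := by rw [inter_comm]; exact h.inter_eq_right
  inter_eq_right := by rw [inter_comm]; exact h.inter_eq_left

theorem unitCircleBundle_subset {B : Type*} {V : B → Type*} [∀ x, NormedAddCommGroup (V x)] :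
    unitCircleBundle V ⊆ closedDiskBundle V := fun v hv ↦ le_of_eq (show ‖v.2‖ = 1 from hv)

theorem continuous_zeroSection_totalSpace {B : Type*} [TopologicalSpace B] (V : B → Type*)
    [TopologicalSpace (TotalSpace Plane V)] [∀ x, NormedAddCommGroup (V x)]
    [∀ x, InnerProductSpace ℝ (V x)] [FiberBundle Plane V] [VectorBundle ℝ Plane V] :
    Continuous fun b ↦ (⟨b, 0⟩ : TotalSpace Plane V) := by
  rw [continuous_iff_continuousAt]
  intro b
  rw [FiberBundle.continuousAt_totalSpace]
  refine ⟨continuousAt_id, ?_⟩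
  set e := trivializationAt Plane V b
  have hb : b ∈ e.baseSet := FiberBundle.mem_baseSet_trivializationAt' b
  refine (continuousAt_const (y := (0 : Plane))).congr ?_
  filter_upwards [e.open_baseSet.mem_nhds hb] with c hc
  exact (e.linear ℝ hc).map_zero.symm

theorem zero_mem_closedDiskBundle {B : Type*} {V : B → Type*} [∀ x, NormedAddCommGroup (V x)]
    (b : B) : (⟨b, 0⟩ : TotalSpace Plane V) ∈ closedDiskBundle V := by
  simp [closedDiskBundle]

/-- If a simply connected space is the union of two closed disk bundles along their common boundary,
over a path connected base `F` and a base `N`, then the fundamental group of `F` is cyclic, and `N`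
is path connected.

The open sets to which `isCyclic_fundamentalGroup_of_union` is applied are the complement of the
zero section `N` and the complement of the disk bundle over `F`. Radial projection away from `N`
retracts the former to the disk bundle over `F`. -/
theorem IsDiskBundleDecomposition.isCyclic_fundamentalGroup_left [PathConnectedSpace F]
    (hφ : IsClosedEmbedding ((closedDiskBundle V).domRestrict φ))
    (hψ : IsClosedEmbedding ((closedDiskBundle W).domRestrict ψ))
    (hM : IsDiskBundleDecomposition φ ψ) :
    (∀ x : F, IsCyclic (FundamentalGroup F x)) ∧ PathConnectedSpace N := by
  have hp := isLocallyTrivialBundle_unitCircleBundle (V := V)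
  have hE : φ '' unitCircleBundle V = ψ '' unitCircleBundle W :=
    hM.inter_eq_left.symm.trans hM.inter_eq_right
  have : Nonempty (TotalSpace Plane V) := ⟨⟨Classical.arbitrary F, 0⟩⟩
  have : Nonempty (TotalSpace Plane W) := by
    obtain ⟨v, -⟩ := hp.surjective (Classical.arbitrary F)
    obtain ⟨w, -⟩ : φ v ∈ ψ '' unitCircleBundle W := hE ▸ ⟨v, v.2, rfl⟩
    exact ⟨w⟩
  obtain ⟨LF, hLF, hLFφ⟩ := hφ.exists_continuousOn_leftInverse
  obtain ⟨LN, hLN, hLNψ⟩ := hψ.exists_continuousOn_leftInverse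
  have hφc : ContinuousOn φ (closedDiskBundle V) :=
    continuousOn_iff_continuous_domRestrict.2 hφ.continuous
  have hψc : ContinuousOn ψ (closedDiskBundle W) :=
    continuousOn_iff_continuous_domRestrict.2 hψ.continuous
  have hclosedF : IsClosed (φ '' closedDiskBundle V) := by
    simpa [range_domRestrict] using hφ.isClosed_range
  have hclosedN : IsClosed (ψ '' closedDiskBundle W) := by
    simpa [range_domRestrict] using hψ.isClosed_range
  -- The two descriptions of the common boundary as a circle bundle.
  have memW (v : unitCircleBundle V) : LN (φ v) ∈ unitCircleBundle W ∧ ψ (LN (φ v)) = φ v := by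
    obtain ⟨w, hw, hwv⟩ : φ v ∈ ψ '' unitCircleBundle W := hE ▸ ⟨v, v.2, rfl⟩
    rw [← hwv, hLNψ w (unitCircleBundle_subset hw)]
    exact ⟨hw, rfl⟩
  have memV (w : unitCircleBundle W) : LF (ψ w) ∈ unitCircleBundle V ∧ φ (LF (ψ w)) = ψ w := by
    obtain ⟨v, hv, hvw⟩ : ψ w ∈ φ '' unitCircleBundle V := hE ▸ ⟨w, w.2, rfl⟩
    rw [← hvw, hLFφ v (unitCircleBundle_subset hv)]
    exact ⟨hv, rfl⟩
  let κ : unitCircleBundle V ≃ₜ unitCircleBundle W :=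
    { toFun v := ⟨LN (φ v), (memW v).1⟩
      invFun w := ⟨LF (ψ w), (memV w).1⟩
      left_inv v := Subtype.ext (by
        change LF (ψ (LN (φ v))) = v
        rw [(memW v).2, hLFφ v (unitCircleBundle_subset v.2)])
      right_inv w := Subtype.ext (by
        change LN (φ (LF (ψ w))) = w
        rw [(memV w).2, hLNψ w (unitCircleBundle_subset w.2)])
      continuous_toFun := by
        refine Continuous.subtype_mk (hLN.comp_continuous (hφc.comp_continuous
          continuous_subtype_val fun v ↦ unitCircleBundle_subset v.2) fun v ↦ ?_) _
        exact ⟨LN (φ v), unitCircleBundle_subset (memW v).1, (memW v).2⟩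
      continuous_invFun := by
        refine Continuous.subtype_mk (hLF.comp_continuous (hψc.comp_continuous
          continuous_subtype_val fun v ↦ unitCircleBundle_subset v.2) fun w ↦ ?_) _
        exact ⟨LF (ψ w), unitCircleBundle_subset (memV w).1, (memV w).2⟩ }
  let q : unitCircleBundle V → N := fun v ↦ (κ v).1.proj
  have hq : IsLocallyTrivialBundle Circle q := fun y ↦ by
    obtain ⟨e, he⟩ := isLocallyTrivialBundle_unitCircleBundle (V := W) y
    exact ⟨e.compHomeomorph κ, he⟩
  have hpc := hp.pathConnectedSpace
  refine ⟨fun x ↦ ?_, hq.surjective.pathConnectedSpace hq.continuous⟩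
  let zN : N → M := fun y ↦ ψ ⟨y, 0⟩
  have hzN : range zN = ψ '' {w | ‖w.2‖ = 0} := by
    ext m
    constructor
    · rintro ⟨y, rfl⟩
      exact ⟨_, by simp, rfl⟩
    · rintro ⟨⟨y, w⟩, hw, rfl⟩
      obtain rfl : w = 0 := norm_eq_zero.1 hw
      exact ⟨y, rfl⟩
  have hA : IsOpen (range zN)ᶜ := by
    rw [isOpen_compl_iff, hzN]
    have h := hψ.isClosedMap _ ((isClosed_singleton (x := (0 : ℝ))).preimage
      ((continuous_norm_totalSpace (V := W)).comp continuous_subtype_val))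
    convert h using 1
    ext m
    constructor
    · rintro ⟨w, hw, rfl⟩
      exact ⟨⟨w, by simp [closedDiskBundle, show ‖w.2‖ = 0 from hw]⟩, hw, rfl⟩
    · rintro ⟨w, hw, rfl⟩
      exact ⟨w, hw, rfl⟩
  have hB : IsOpen (φ '' closedDiskBundle V)ᶜ := hclosedF.isOpen_compl
  have hAB (m : M) : m ∈ (range zN)ᶜ ∨ m ∈ (φ '' closedDiskBundle V)ᶜ := by
    rw [← mem_union, ← compl_inter]
    rintro ⟨⟨y, rfl⟩, hy⟩
    have : zN y ∈ ψ '' unitCircleBundle W := by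
      rw [← hM.inter_eq_right]
      exact ⟨hy, _, zero_mem_closedDiskBundle y, rfl⟩
    obtain ⟨w, hw, hwy⟩ := this
    have h₁ := hLNψ w (unitCircleBundle_subset hw)
    rw [hwy, hLNψ _ (zero_mem_closedDiskBundle y)] at h₁
    have h₂ : ‖w.2‖ = 1 := hw
    rw [← h₁] at h₂
    simp at h₂
  have mem_or (m : M) : m ∈ φ '' closedDiskBundle V ∨ m ∈ ψ '' closedDiskBundle W := by
    rw [← mem_union, hM.cover]
    trivial
  have LN_ne_zero {m : M} (hm : m ∈ (range zN)ᶜ) (hm' : m ∈ ψ '' closedDiskBundle W) :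
      (LN m).2 ≠ 0 := by
    obtain ⟨⟨y, w⟩, hw, rfl⟩ := hm'
    rw [hLNψ _ hw]
    intro h
    obtain rfl : w = 0 := h
    exact hm ⟨y, rfl⟩
  -- The boundary point at the end of the radius through a point of the disk bundle over `N`.
  let ρ : M → unitCircleBundle V := fun m ↦ κ.symm (radialProjection (LN m))
  have hρ : ContinuousOn ρ ((range zN)ᶜ ∩ ψ '' closedDiskBundle W) :=
    κ.symm.continuous.comp_continuousOn (continuousOn_radialProjection.comp
      (hLN.mono inter_subset_right) fun m hm ↦ LN_ne_zero hm.1 hm.2)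
  classical
  let aFun : M → F := fun m ↦ if m ∈ φ '' closedDiskBundle V then (LF m).proj else (ρ m).1.proj
  have aFun_eq {m : M} (hm : m ∈ ψ '' closedDiskBundle W) : aFun m = (ρ m).1.proj := by
    by_cases h : m ∈ φ '' closedDiskBundle V
    · obtain ⟨w, hw, rfl⟩ : m ∈ ψ '' unitCircleBundle W := hM.inter_eq_right ▸ ⟨h, hm⟩
      simp only [aFun, ρ, if_pos h]
      rw [hLNψ _ (unitCircleBundle_subset hw), radialProjection_coe ⟨w, hw⟩]
      rfl
    · exact if_neg h
  have haFun : Continuous fun m : ↥(range zN)ᶜ ↦ aFun m := by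
    rw [← continuousOn_univ]
    have hunion : (Subtype.val ⁻¹' (φ '' closedDiskBundle V) : Set ↥(range zN)ᶜ) ∪
        Subtype.val ⁻¹' (ψ '' closedDiskBundle W) = univ :=
      eq_univ_of_forall fun m ↦ mem_or m
    rw [← hunion]
    refine ContinuousOn.union_of_isClosed ?_ ?_ (hclosedF.preimage continuous_subtype_val)
      (hclosedN.preimage continuous_subtype_val)
    · refine ContinuousOn.congr (f := fun m : ↥(range zN)ᶜ ↦ (LF m).proj) ?_ fun m hm ↦ if_pos hm
      exact (FiberBundle.continuous_proj Plane V).comp_continuousOn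
        (hLF.comp continuous_subtype_val.continuousOn fun m hm ↦ hm)
    · refine ContinuousOn.congr (f := fun m : ↥(range zN)ᶜ ↦ (ρ m).1.proj) ?_ fun m hm ↦ aFun_eq hm
      exact ((FiberBundle.continuous_proj Plane V).comp continuous_subtype_val).comp_continuousOn
        (hρ.comp continuous_subtype_val.continuousOn fun m hm ↦ ⟨m.2, hm⟩)
  have memN {m : M} (hm : m ∈ (φ '' closedDiskBundle V)ᶜ) : m ∈ ψ '' closedDiskBundle W :=
    (mem_or m).resolve_left hm
  have zero_memF (x : F) : φ ⟨x, 0⟩ ∈ φ '' closedDiskBundle V :=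
    ⟨_, zero_mem_closedDiskBundle x, rfl⟩
  refine isCyclic_fundamentalGroup_of_union hA hB hAB hp hq ⟨_, haFun⟩
    ⟨fun m ↦ (LN m).proj, (FiberBundle.continuous_proj Plane W).comp
      (hLN.comp_continuous continuous_subtype_val fun m ↦ memN m.2)⟩
    ⟨fun m ↦ ρ m, hρ.comp_continuous continuous_subtype_val fun m ↦ ⟨m.2.1, memN m.2.2⟩⟩
    (fun m ↦ (aFun_eq (memN m.2.2)).symm) (fun m ↦ ?_)
    ⟨fun x ↦ φ ⟨x, 0⟩, hφc.comp_continuous (continuous_zeroSection_totalSpace V)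
      fun x ↦ zero_mem_closedDiskBundle x⟩ (fun x ↦ ?_) (fun x ↦ ?_) x
  · change (κ (κ.symm (radialProjection (LN m)))).1.proj = _
    rw [κ.apply_symm_apply, proj_radialProjection]
    rfl
  · exact (hAB _).resolve_right fun h ↦ h (zero_memF x)
  · change aFun (φ ⟨x, 0⟩) = x
    simp only [aFun, if_pos (zero_memF x)]
    rw [hLFφ _ (zero_mem_closedDiskBundle x)]

end Decomposition

theorem IsContMDiffRiemannianBundle.isContinuousRiemannianBundle {EB HB B F : Type*}
    [NormedAddCommGroup EB] [NormedSpace ℝ EB] [TopologicalSpace HB] (IB : ModelWithCorners ℝ EB HB)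
    (k : WithTop ℕ∞) [TopologicalSpace B] [ChartedSpace HB B] [NormedAddCommGroup F]
    [NormedSpace ℝ F] (V : B → Type*) [TopologicalSpace (Bundle.TotalSpace F V)]
    [∀ x, NormedAddCommGroup (V x)] [∀ x, InnerProductSpace ℝ (V x)] [FiberBundle F V]
    [VectorBundle ℝ F V] [h : IsContMDiffRiemannianBundle IB k F V] :
    IsContinuousRiemannianBundle F V := by
  obtain ⟨g, hg, hg'⟩ := h.exists_contMDiff
  exact ⟨g, hg.continuous, hg'⟩

/-! ### Fundamental groups of the bases of the disk bundles in `M` -/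

theorem mainTheorem9
    (n : ℕ) (hn : 3 ≤ n)
    -- the closed simply connected smooth manifold `M` of dimension `n`
    (M : Type*) [TopologicalSpace M] [T2Space M] [CompactSpace M] [SimplyConnectedSpace M]
    [ChartedSpace (EuclideanSpace ℝ (Fin n)) M] [IsManifold (𝓡 n) ∞ M]
    -- with a smooth fixed point homogeneous circle action
    [MulAction Circle M] [ContMDiffSMul (𝓡 1) (𝓡 n) ∞ Circle M]
    (hfph : IsFixedPointHomogeneous Circle M)
    -- a component `F` of the fixed point set, of codimension two
    (F : Type*) [TopologicalSpace F]
    [ChartedSpace (EuclideanSpace ℝ (Fin (n - 2))) F] [IsManifold (𝓡 (n - 2)) ∞ F]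
    (ιF : F → M) (hιF : Manifold.IsSmoothEmbedding (𝓡 (n - 2)) (𝓡 n) ∞ ιF)
    (hF : ∃ p ∈ MulAction.fixedPoints Circle M,
      Set.range ιF = connectedComponentIn (MulAction.fixedPoints Circle M) p)
    -- an invariant submanifold `N` of codimension two
    (N : Type*) [TopologicalSpace N]
    [ChartedSpace (EuclideanSpace ℝ (Fin (n - 2))) N] [IsManifold (𝓡 (n - 2)) ∞ N]
    (ιN : N → M) (hιN : Manifold.IsSmoothEmbedding (𝓡 (n - 2)) (𝓡 n) ∞ ιN)
    (hN : ∀ (g : Circle), ∀ x ∈ Set.range ιN, g • x ∈ Set.range ιN)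
    -- containing all singularities of the action outside of `F`
    (hsing : ∀ x : M, ¬ HasPrincipalOrbit Circle x → x ∉ Set.range ιF → x ∈ Set.range ιN)
    -- the disk bundle `D(F)`
    (V : F → Type*) [TopologicalSpace (Bundle.TotalSpace Plane V)]
    [∀ x, NormedAddCommGroup (V x)] [∀ x, InnerProductSpace ℝ (V x)]
    [FiberBundle Plane V] [VectorBundle ℝ Plane V]
    [ContMDiffVectorBundle ∞ Plane V (𝓡 (n - 2))]
    [IsContMDiffRiemannianBundle (𝓡 (n - 2)) ∞ Plane V]
    (φ : Bundle.TotalSpace Plane V → M) (hφ : IsTubularDiskBundle (n := n) (b := n - 2) ιF V φ)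
    -- the disk bundle `D(N)`
    (W : N → Type*) [TopologicalSpace (Bundle.TotalSpace Plane W)]
    [∀ x, NormedAddCommGroup (W x)] [∀ x, InnerProductSpace ℝ (W x)]
    [FiberBundle Plane W] [VectorBundle ℝ Plane W]
    [ContMDiffVectorBundle ∞ Plane W (𝓡 (n - 2))]
    [IsContMDiffRiemannianBundle (𝓡 (n - 2)) ∞ Plane W]
    (ψ : Bundle.TotalSpace Plane W → M) (hψ : IsTubularDiskBundle (n := n) (b := n - 2) ιN W ψ)
    -- `M = D(F) ∪_E D(N)`
    (hM : IsDiskBundleDecomposition φ ψ) :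
    (∀ x : F, IsCyclic (FundamentalGroup F x)) ∧ (∀ y : N, IsCyclic (FundamentalGroup N y)) := by
  obtain ⟨p, hp, hrange⟩ := hF
  -- `F` is path connected, being a connected manifold.
  have hFconn : ConnectedSpace F := by
    have h : IsConnected (ιF '' Set.univ) := by
      rw [Set.image_univ, hrange]
      exact isConnected_connectedComponentIn_iff.2 hp
    exact connectedSpace_iff_univ.2 ⟨h.nonempty.of_image,
      hιF.isEmbedding.isInducing.isPreconnected_image.1 h.isPreconnected⟩
  have : LocallyPathConnectedSpace F :=
    ChartedSpace.locallyPathConnectedSpace (EuclideanSpace ℝ (Fin (n - 2))) F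
  have : PathConnectedSpace F := pathConnectedSpace_iff_connectedSpace.2 hFconn
  have := IsContMDiffRiemannianBundle.isContinuousRiemannianBundle (F := Plane) (𝓡 (n - 2)) ∞ V
  have := IsContMDiffRiemannianBundle.isContinuousRiemannianBundle (F := Plane) (𝓡 (n - 2)) ∞ W
  obtain ⟨hcyclicF, hNconn⟩ :=
    hM.isCyclic_fundamentalGroup_left hφ.isClosedEmbedding hψ.isClosedEmbedding
  exact ⟨hcyclicF, (hM.symm.isCyclic_fundamentalGroup_left hψ.isClosedEmbedding
    hφ.isClosedEmbedding).1⟩
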